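/- Let $n<d$, $m>n+1$ and $q\ge 1$ be integers, let $A\in\mathbb{R}^{n\times d}$ have full row rank $n$, and let $b\in\mathbb{R}^n$ with $b\neq 0$. Put $f(x)=\|x\|_2^2$ and let $$x^*=\arg\min_{x\in\mathbb{R}^d}\|x\|_2^2\quad\text{s.t.}\quad Ax=b .$$ Let $S_1,\dots,S_q\in\mathbb{R}^{m\times d}$ be independent Gaussian sketching matrices, i.e. random matrices whose entries are i.i.d. $\mathcal N(0,1/m)$ (so that $\mathbb{E}[S_k^TS_k]=I_d$). For each $k$ let $$\hat z_k=\arg\min_{z\in\mathbb{R}^m}\|z\|_2^2\quad\text{s.t.}\quad AS_k^Tz=b,\qquad \hat x_k=S_k^T\hat z_k,\qquad \bar x=\frac1q\sum_{k=1}^q\hat x_k .$$ Then $x^*$ is well defined (the minimizer exists and is unique) with $f(x^*)>0$, almost surely all $\hat z_k$ are well defined, $f(\bar x)$ is integrable, and $$\frac{\mathbb{E}[f(\bar x)]-f(x^*)}{f(x^*)}=\frac1q\,\frac{d-n}{m-n-1}.$$ Consequently, for every $\epsilon>0$, $$\mathbb{P}\left(\frac{f(\bar x)-f(x^*)}{f(x^*)}\le\epsilon\right)\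 \ge\ 1-\frac{1}{q\epsilon}\,\frac{d-n}{m-n-1}.$$ -/

import Mathlib

open MeasureTheory ProbabilityTheory
open scoped NNReal Matrix

namespace RightSketch

/-- The objective `f(x) = ‖x‖₂²` (Euclidean norm). -/
noncomputable def cost {d : ℕ} (x : EuclideanSpace ℝ (Fin d)) : ℝ := ‖x‖ ^ 2

/-- `x` solves `min ‖x‖₂²` subject to `M x = b`. -/
def IsLeastNormSolution {n d : ℕ} (M : Matrix (Fin n) (Fin d) ℝ) (b : Fin n → ℝ)
    (x : EuclideanSpace ℝ (Fin d)) : Prop :=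
  M *ᵥ x.ofLp = b ∧ ∀ y : EuclideanSpace ℝ (Fin d), M *ᵥ y.ofLp = b → cost x ≤ cost y

/-- A consistent linear system has exactly one solution of least norm. -/
theorem existsUnique_isLeastNormSolution {n d : ℕ} (M : Matrix (Fin n) (Fin d) ℝ)
    (b : Fin n → ℝ) (h : ∃ v : Fin d → ℝ, M *ᵥ v = b) :
    ∃! x, IsLeastNormSolution M b x := by
  have hlin : Continuous fun x : EuclideanSpace ℝ (Fin d) => M *ᵥ x.ofLp := by fun_prop
  have hmin : ∃ x, IsLeastNormSolution M b x := by
    obtain ⟨v, hv⟩ := h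
    have hclosed : IsClosed {x : EuclideanSpace ℝ (Fin d) | M *ᵥ x.ofLp = b} :=
      isClosed_eq hlin continuous_const
    have hne : {x : EuclideanSpace ℝ (Fin d) | M *ᵥ x.ofLp = b}.Nonempty :=
      ⟨WithLp.toLp 2 v, hv⟩
    obtain ⟨x, hx, hdist⟩ := hclosed.exists_infDist_eq_dist hne 0
    refine ⟨x, hx, fun y hy => ?_⟩
    have h1 := Metric.infDist_le_dist_of_mem (x := (0 : EuclideanSpace ℝ (Fin d)))
      (show y ∈ {x : EuclideanSpace ℝ (Fin d) | M *ᵥ x.ofLp = b} from hy)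
    rw [hdist, dist_zero_left, dist_zero_left] at h1
    unfold cost
    gcongr
  obtain ⟨x, hx⟩ := hmin
  refine ⟨x, hx, fun y hy => ?_⟩
  have hmid : M *ᵥ ((2⁻¹ : ℝ) • (x + y)).ofLp = b := by
    rw [WithLp.ofLp_smul, WithLp.ofLp_add, Matrix.mulVec_smul, Matrix.mulVec_add, hx.1, hy.1,
      ← two_smul ℝ b, smul_smul]
    norm_num
  have h1 := hx.2 _ hmid
  have h2 := hy.2 _ hx.1
  have h3 := parallelogram_law_with_norm ℝ x y
  unfold cost at h1 h2
  rw [norm_smul, mul_pow] at h1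
  norm_num at h1
  have h4 : ‖x - y‖ = 0 := by
    have : ‖x - y‖ * ‖x - y‖ ≤ 0 := by nlinarith
    nlinarith [norm_nonneg (x - y)]
  exact (sub_eq_zero.mp (norm_eq_zero.mp h4)).symm

open Classical in
/-- The least-norm solution `argmin ‖x‖₂²` subject to `M x = b`; it is unique whenever the system
is consistent. The value on an inconsistent system is an irrelevant default. -/
noncomputable def leastNormSolution {n d : ℕ} (M : Matrix (Fin n) (Fin d) ℝ) (b : Fin n → ℝ) :
    EuclideanSpace ℝ (Fin d) :=
  if h : ∃ x, IsLeastNormSolution M b x then h.choose else 0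

theorem leastNormSolution_spec {n d : ℕ} {M : Matrix (Fin n) (Fin d) ℝ} {b : Fin n → ℝ}
    (h : ∃ v : Fin d → ℝ, M *ᵥ v = b) :
    IsLeastNormSolution M b (leastNormSolution M b) := by
  have h' := (existsUnique_isLeastNormSolution M b h).exists
  unfold leastNormSolution
  rw [dif_pos h']
  exact h'.choose_spec

/-- The right-sketch estimator `x̂ = Sᵀ ẑ`, where `ẑ` is the least-norm solution of
`A Sᵀ z = b`. -/
noncomputable def rightSketchEstimator {n d m : ℕ} (A : Matrix (Fin n) (Fin d) ℝ)
    (b : Fin n → ℝ) (S : Matrix (Fin m) (Fin d) ℝ) : EuclideanSpace ℝ (Fin d) :=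
  WithLp.toLp 2 (Sᵀ *ᵥ (leastNormSolution (A * Sᵀ) b).ofLp)

/-- The average `x̄ = (1/q) ∑ₖ x̂ₖ` of the outputs of `q` workers. -/
noncomputable def averagedEstimator {n d m q : ℕ} (A : Matrix (Fin n) (Fin d) ℝ)
    (b : Fin n → ℝ) (S : Fin q → Matrix (Fin m) (Fin d) ℝ) : EuclideanSpace ℝ (Fin d) :=
  (1 / (q : ℝ)) • ∑ k, rightSketchEstimator A b (S k)

/-- A Gaussian sketch: a random `m × d` matrix with independent entries of law `N(0, 1/m)`, which
is the scaling for which `E[SᵀS] = I`. -/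
structure IsGaussianSketch {Ω : Type*} [MeasurableSpace Ω] (P : Measure Ω) {m d : ℕ}
    (S : Ω → Matrix (Fin m) (Fin d) ℝ) : Prop where
  hasLaw_entry : ∀ i j, HasLaw (fun ω => S ω i j) (gaussianReal 0 (m : ℝ≥0)⁻¹) P
  indep_entries : iIndepFun (fun (p : Fin m × Fin d) ω => S ω p.1 p.2) P

end RightSketch

/-!
Let `K` be the kernel of `A`, `r = d - n` its dimension and `s` the least-norm solution, which is
orthogonal to `K`. Every feasible `x` satisfies `‖x‖² = ‖s‖² + ∑ⱼ ⟪eⱼ, x⟫²` for an orthonormal basis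
`e₁, …, eᵣ` of `K`, so the excess cost of the average is a sum of squares of averaged kernel
coordinates.

Extend `e` by an orthonormal basis `w₀, …` of the row space of `A` with `w₀ = s / ‖s‖`
(`exists_adapted_orthonormal`). For a Gaussian sketch `S` the vectors `S wᵢ` and `S eⱼ` are
independent isotropic Gaussian vectors of variance `1 / m` (`IsGaussianSketch.iIndepFun_mulVec`).
The sketched constraint reads `⟪S w₀, z⟫ = ‖s‖` and `⟪S wᵢ, z⟫ = 0` for `i ≥ 1`, so `ẑ` is a
function of the `S wᵢ` alone, and `⟪eⱼ, x̂⟫ = ⟪S eⱼ, ẑ⟫` is, conditionally on `ẑ`, centred of variance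
`‖ẑ‖² / m` (`integrable_inner_sq_and_integral`).

It remains to compute `E ‖ẑ‖²`. One has `‖ẑ‖² = ‖s‖² / ‖p‖²` with `p` the component of `S w₀`
orthogonal to the other `S wᵢ` (`norm_sq_leastNormSolution_consMatrix`), and `m ‖p‖²` is chi-squared
with `m - n + 1` degrees of freedom. Writing `1 / ‖p‖² = ∫₀^∞ exp (-t ‖p‖²) dt` gives
`E ‖ẑ‖² = m ‖s‖² / (m - n - 1)` (`lintegral_inv_norm_sq_isoGaussian`,
`lintegral_norm_sq_normalSolution`). Each of the `d - n` kernel coordinates thus has variance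
`‖s‖² / (m - n - 1)`, averaging `q` independent copies divides it by `q`
(`integral_average_sketchCoord_sq`), and the probability bound is Markov's inequality.
-/

namespace RightSketch

/-! ### Isotropic Gaussian vectors and Gaussian sketches -/

/-- The centred isotropic Gaussian measure on `EuclideanSpace ℝ ι` whose coordinates are
independent of variance `v`. -/
noncomputable def isoGaussian (ι : Type*) [Fintype ι] (v : ℝ≥0) :
    Measure (EuclideanSpace ℝ ι) :=
  (Measure.pi fun _ : ι => gaussianReal 0 v).map (WithLp.toLp 2)

section IsoGaussian

variable {ι κ : Type*} [Fintype ι] [Fintype κ] {v : ℝ≥0}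

instance isProbabilityMeasure_isoGaussian : IsProbabilityMeasure (isoGaussian ι v) :=
  Measure.isProbabilityMeasure_map (by fun_prop)

theorem charFun_isoGaussian (t : EuclideanSpace ℝ ι) :
    charFun (isoGaussian ι v) t = Complex.exp (-(v * ‖t‖ ^ 2 / 2 : ℝ)) := by
  rw [isoGaussian, charFun_pi]
  simp_rw [charFun_gaussianReal, ← Complex.exp_sum, EuclideanSpace.real_norm_sq_eq]
  congr 1
  push_cast
  simp [Finset.sum_div, Finset.mul_sum]

theorem hasLaw_isoGaussian_of_charFun {Ω : Type*} [MeasurableSpace Ω] {P : Measure Ω}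
    [IsProbabilityMeasure P] {X : Ω → EuclideanSpace ℝ ι} (hX : AEMeasurable X P)
    (h : ∀ t, charFun (P.map X) t = Complex.exp (-(v * ‖t‖ ^ 2 / 2 : ℝ))) :
    HasLaw X (isoGaussian ι v) P where
  aemeasurable := hX
  map_eq := by
    have := Measure.isProbabilityMeasure_map hX
    apply Measure.ext_of_charFun
    ext t
    rw [h, charFun_isoGaussian]

/-- The coordinates of an isotropic Gaussian vector along an orthonormal family form an isotropic
Gaussian vector. -/
theorem hasLaw_inner_orthonormal {w : κ → EuclideanSpace ℝ ι} (hw : Orthonormal ℝ w) :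
    HasLaw (fun x : EuclideanSpace ℝ ι => WithLp.toLp 2 fun j => inner ℝ (w j) x)
      (isoGaussian κ v) (isoGaussian ι v) := by
  refine hasLaw_isoGaussian_of_charFun (by fun_prop) fun t => ?_
  have hnorm : ‖∑ j, t j • w j‖ ^ 2 = ‖t‖ ^ 2 := by
    rw [← real_inner_self_eq_norm_sq, hw.inner_sum, EuclideanSpace.real_norm_sq_eq]
    simp [sq]
  rw [← hnorm, ← charFun_isoGaussian, charFun_apply, charFun_apply,
    integral_map (by fun_prop) (by fun_prop)]
  congr with x
  congr 3
  simp only [PiLp.inner_apply, inner_sum, RCLike.inner_apply, conj_trivial, inner_smul_right]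
  refine Finset.sum_congr rfl fun j _ => ?_
  congr 1
  exact Finset.sum_congr rfl fun j _ => mul_comm _ _

theorem hasLaw_eval_isoGaussian (i : ι) :
    HasLaw (fun x : EuclideanSpace ℝ ι => x i) (gaussianReal 0 v) (isoGaussian ι v) where
  aemeasurable := by fun_prop
  map_eq := by
    rw [isoGaussian, Measure.map_map (by fun_prop) (by fun_prop)]
    exact (measurePreserving_eval _ i).map_eq

theorem hasLaw_inner_unit {u : EuclideanSpace ℝ ι} (hu : ‖u‖ = 1) :
    HasLaw (fun x : EuclideanSpace ℝ ι => inner ℝ u x) (gaussianReal 0 v) (isoGaussian ι v) := by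
  have hw : Orthonormal ℝ (fun _ : Unit => u) := ⟨fun _ => hu, fun i j h => (h rfl).elim⟩
  exact (hasLaw_eval_isoGaussian ()).fun_comp (hasLaw_inner_orthonormal hw)

theorem memLp_inner_isoGaussian (z : EuclideanSpace ℝ ι) :
    MemLp (fun x : EuclideanSpace ℝ ι => inner ℝ z x) 2 (isoGaussian ι v) := by
  simp only [PiLp.inner_apply]
  refine memLp_finsetSum _ fun i _ => ?_
  have h : MemLp (fun x : EuclideanSpace ℝ ι => x i) 2 (isoGaussian ι v) :=
    (hasLaw_eval_isoGaussian i).hasGaussianLaw.memLp_two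
  simpa [mul_comm] using! h.const_mul (z i)

theorem integral_inner_isoGaussian (z : EuclideanSpace ℝ ι) :
    ∫ x, inner ℝ z x ∂(isoGaussian ι v) = 0 := by
  simp only [PiLp.inner_apply]
  rw [integral_finsetSum]
  · refine Finset.sum_eq_zero fun i _ => ?_
    have := (hasLaw_eval_isoGaussian (v := v) i).integral_eq
    simp only [integral_id_gaussianReal] at this
    simp [integral_mul_const, this]
  · intro i _
    have h : Integrable (fun x : EuclideanSpace ℝ ι => x i) (isoGaussian ι v) :=
      (hasLaw_eval_isoGaussian i).hasGaussianLaw.integrable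
    simpa [mul_comm] using! h.const_mul (z i)

theorem integral_inner_sq_isoGaussian (z : EuclideanSpace ℝ ι) :
    ∫ x, (inner ℝ z x : ℝ) ^ 2 ∂(isoGaussian ι v) = v * ‖z‖ ^ 2 := by
  rcases eq_or_ne z 0 with rfl | hz
  · simp
  have hu : ‖‖z‖⁻¹ • z‖ = 1 := norm_smul_inv_norm (𝕜 := ℝ) hz
  have h := (hasLaw_inner_unit (v := v) hu).integral_comp (f := fun y => y ^ 2) (by fun_prop)
  have hvar : ∫ y, y ^ 2 ∂(gaussianReal 0 v) = v := by
    have := variance_eq_sub (μ := gaussianReal 0 v) (X := id) IsGaussian.memLp_two_id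
    simpa using! this.symm
  rw [hvar] at h
  simp only [Function.comp_def, inner_smul_left, mul_pow, conj_trivial] at h
  rw [integral_const_mul] at h
  have hz' : ‖z‖ ≠ 0 := norm_ne_zero_iff.2 hz
  field_simp at h
  linarith

end IsoGaussian

section Sketch

variable {Ω : Type*} [MeasurableSpace Ω] {P : Measure Ω} {m d : ℕ}

theorem IsGaussianSketch.hasLaw_toLp {S : Ω → Matrix (Fin m) (Fin d) ℝ}
    (hS : IsGaussianSketch P S) :
    HasLaw (fun ω => (WithLp.toLp 2 fun p : Fin m × Fin d => S ω p.1 p.2 :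
      EuclideanSpace ℝ (Fin m × Fin d))) (isoGaussian (Fin m × Fin d) (m : ℝ≥0)⁻¹) P := by
  have h1 := hS.indep_entries.hasLaw_pi
    (μ := fun _ => gaussianReal 0 (m : ℝ≥0)⁻¹) fun p : Fin m × Fin d => hS.hasLaw_entry p.1 p.2
  exact HasLaw.fun_comp ⟨by fun_prop, rfl⟩ h1

theorem IsGaussianSketch.aemeasurable_mulVec {S : Ω → Matrix (Fin m) (Fin d) ℝ}
    (hS : IsGaussianSketch P S) (u : EuclideanSpace ℝ (Fin d)) :
    AEMeasurable (fun ω => (WithLp.toLp 2 (S ω *ᵥ u.ofLp) : EuclideanSpace ℝ (Fin m))) P := by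
  have hentry : ∀ i j, AEMeasurable (fun ω => S ω i j) P := fun i j =>
    (hS.hasLaw_entry i j).aemeasurable
  refine (by fun_prop : Measurable
    (WithLp.toLp 2 : _ → EuclideanSpace ℝ (Fin m))).comp_aemeasurable ?_
  refine aemeasurable_pi_lambda _ fun a => ?_
  simp only [Matrix.mulVec, dotProduct]
  fun_prop

theorem IsGaussianSketch.aemeasurable_toLp_mulVec {S : Ω → Matrix (Fin m) (Fin d) ℝ}
    (hS : IsGaussianSketch P S) {κ : Type*} [Fintype κ] (w : κ → EuclideanSpace ℝ (Fin d)) :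
    AEMeasurable (fun ω => (WithLp.toLp 2 fun j => WithLp.toLp 2 (S ω *ᵥ (w j).ofLp) :
      PiLp 2 (fun _ : κ => EuclideanSpace ℝ (Fin m)))) P :=
  (by fun_prop : Measurable (WithLp.toLp 2 :
    _ → PiLp 2 (fun _ : κ => EuclideanSpace ℝ (Fin m)))).comp_aemeasurable
    (aemeasurable_pi_lambda _ fun j => hS.aemeasurable_mulVec (w j))

/-- The joint characteristic function of the images `S wⱼ` of an orthonormal family is that of
the vectorized sketch at the matrix `∑ⱼ tⱼ wⱼᵀ`, whose Frobenius norm is that of `t`. -/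
theorem IsGaussianSketch.charFun_mulVec [IsProbabilityMeasure P]
    {S : Ω → Matrix (Fin m) (Fin d) ℝ} (hS : IsGaussianSketch P S) {κ : Type*} [Fintype κ]
    {w : κ → EuclideanSpace ℝ (Fin d)} (hw : Orthonormal ℝ w)
    (t : PiLp 2 (fun _ : κ => EuclideanSpace ℝ (Fin m))) :
    charFun (P.map fun ω => WithLp.toLp 2 fun j =>
      (WithLp.toLp 2 (S ω *ᵥ (w j).ofLp) : EuclideanSpace ℝ (Fin m))) t =
      Complex.exp (-((m : ℝ≥0)⁻¹ * (∑ j, ‖t j‖ ^ 2) / 2 : ℝ)) := by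
  let T : EuclideanSpace ℝ (Fin m × Fin d) := WithLp.toLp 2 fun p => ∑ j, t j p.1 * w j p.2
  have hT : ‖T‖ ^ 2 = ∑ j, ‖t j‖ ^ 2 := by
    have hrow : ∀ a : Fin m, ∑ i, (∑ j, t j a * w j i) ^ 2 = ∑ j, t j a ^ 2 := by
      intro a
      have h1 : ‖∑ j, t j a • w j‖ ^ 2 = ∑ j, t j a ^ 2 := by
        rw [← real_inner_self_eq_norm_sq, hw.inner_sum]
        simp [sq]
      rw [← h1, EuclideanSpace.real_norm_sq_eq]
      simp
    simp_rw [EuclideanSpace.real_norm_sq_eq, T, Fintype.sum_prod_type, hrow]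
    exact Finset.sum_comm
  have hTS : ∀ ω, inner ℝ (WithLp.toLp 2 fun j =>
      (WithLp.toLp 2 (S ω *ᵥ (w j).ofLp) : EuclideanSpace ℝ (Fin m))) t =
      inner ℝ (WithLp.toLp 2 fun p : Fin m × Fin d => S ω p.1 p.2 :
        EuclideanSpace ℝ (Fin m × Fin d)) T := by
    intro ω
    simp only [PiLp.inner_apply, RCLike.inner_apply, conj_trivial, Matrix.mulVec, dotProduct,
      T, Fintype.sum_prod_type, Finset.mul_sum, Finset.sum_mul]
    rw [Finset.sum_comm]
    refine Finset.sum_congr rfl fun a _ => ?_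
    rw [Finset.sum_comm]
    exact Finset.sum_congr rfl fun i _ => Finset.sum_congr rfl fun j _ => by ring
  have hcf := charFun_isoGaussian (v := (m : ℝ≥0)⁻¹) T
  rw [← hS.hasLaw_toLp.map_eq, charFun_apply,
    integral_map hS.hasLaw_toLp.aemeasurable (by fun_prop), hT] at hcf
  rw [charFun_apply, integral_map (hS.aemeasurable_toLp_mulVec w) (by fun_prop)]
  simp_rw [hTS, hcf]

theorem IsGaussianSketch.hasLaw_mulVec [IsProbabilityMeasure P]
    {S : Ω → Matrix (Fin m) (Fin d) ℝ} (hS : IsGaussianSketch P S)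
    {u : EuclideanSpace ℝ (Fin d)} (hu : ‖u‖ = 1) :
    HasLaw (fun ω => (WithLp.toLp 2 (S ω *ᵥ u.ofLp) : EuclideanSpace ℝ (Fin m)))
      (isoGaussian (Fin m) (m : ℝ≥0)⁻¹) P := by
  refine hasLaw_isoGaussian_of_charFun (hS.aemeasurable_mulVec u) fun t => ?_
  have hw : Orthonormal ℝ (fun _ : Unit => u) := ⟨fun _ => hu, fun i j h => (h rfl).elim⟩
  have h := hS.charFun_mulVec hw (WithLp.toLp 2 fun _ => t)
  simp only [Finset.univ_unique, Finset.sum_singleton] at h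
  rw [← h, charFun_apply, charFun_apply, integral_map (hS.aemeasurable_mulVec u) (by fun_prop),
    integral_map (hS.aemeasurable_toLp_mulVec _) (by fun_prop)]
  simp [PiLp.inner_apply]

/-- The images of an orthonormal family of vectors under a Gaussian sketch are independent. -/
theorem IsGaussianSketch.iIndepFun_mulVec [IsProbabilityMeasure P]
    {S : Ω → Matrix (Fin m) (Fin d) ℝ} (hS : IsGaussianSketch P S) {κ : Type*} [Fintype κ]
    {w : κ → EuclideanSpace ℝ (Fin d)} (hw : Orthonormal ℝ w) :
    iIndepFun (fun j ω => (WithLp.toLp 2 (S ω *ᵥ (w j).ofLp) : EuclideanSpace ℝ (Fin m))) P := by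
  refine (iIndepFun_iff_charFun_pi fun j => hS.aemeasurable_mulVec _).2 fun t => ?_
  rw [hS.charFun_mulVec hw]
  simp_rw [fun j => (hS.hasLaw_mulVec (hw.1 j)).map_eq, charFun_isoGaussian, ← Complex.exp_sum]
  congr 1
  push_cast
  simp [Finset.mul_sum, Finset.sum_div]

end Sketch

/-! ### Inverse moments of Gaussian vectors -/

section InverseMoment

/-- The Laplace transform of the square of a centred Gaussian variable. -/
theorem integral_exp_neg_mul_sq_gaussianReal {v : ℝ≥0} (hv : v ≠ 0) {t : ℝ} (ht : 0 ≤ t) :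
    ∫ x, Real.exp (-(t * x ^ 2)) ∂(gaussianReal 0 v) = (1 + 2 * v * t) ^ (-(1 / 2) : ℝ) := by
  have hv' : (0 : ℝ) < v := by positivity
  rw [integral_gaussianReal_eq_integral_smul hv]
  simp only [gaussianPDFReal, sub_zero, smul_eq_mul, mul_assoc, ← Real.exp_add]
  have h : ∀ x : ℝ, -x ^ 2 / (2 * v) + -(t * x ^ 2) = -(1 / (2 * v) + t) * x ^ 2 := by
    intro x; field_simp; ring
  simp_rw [h]
  have hpos : 0 < 1 + 2 * v * t := by positivity
  rw [integral_const_mul, integral_gaussian, ← mul_assoc 2 (v : ℝ), Real.rpow_neg hpos.le,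
    ← Real.sqrt_eq_rpow, ← Real.sqrt_inv, ← Real.sqrt_inv, ← Real.sqrt_mul (by positivity)]
  congr 1
  have := Real.pi_pos
  field_simp

theorem lintegral_exp_neg_mul_norm_sq_isoGaussian {ι : Type*} [Fintype ι] {v : ℝ≥0} (hv : v ≠ 0)
    {t : ℝ} (ht : 0 ≤ t) :
    ∫⁻ x, ENNReal.ofReal (Real.exp (-(t * ‖x‖ ^ 2))) ∂(isoGaussian ι v) =
      ENNReal.ofReal ((1 + 2 * v * t) ^ (-(Fintype.card ι / 2) : ℝ)) := by
  have hint : Integrable (fun x => Real.exp (-(t * ‖x‖ ^ 2))) (isoGaussian ι v) := by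
    refine Integrable.of_bound (by fun_prop) 1 (ae_of_all _ fun x => ?_)
    rw [Real.norm_eq_abs, Real.abs_exp, Real.exp_le_one_iff]
    have : 0 ≤ t * ‖x‖ ^ 2 := by positivity
    linarith
  rw [← ofReal_integral_eq_lintegral_ofReal hint (ae_of_all _ fun x => (Real.exp_pos _).le),
    isoGaussian, integral_map (by fun_prop) (by fun_prop)]
  congr 1
  simp_rw [EuclideanSpace.real_norm_sq_eq, Finset.mul_sum, ← Finset.sum_neg_distrib, Real.exp_sum]
  rw [integral_fintype_prod_eq_prod (f := fun _ x => Real.exp (-(t * x ^ 2)))]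
  simp_rw [integral_exp_neg_mul_sq_gaussianReal hv ht]
  have hpos : (0 : ℝ) ≤ 1 + 2 * v * t := by positivity
  rw [Finset.prod_const, Finset.card_univ, ← Real.rpow_natCast, ← Real.rpow_mul hpos]
  congr 1
  ring

/-- The identity `∫₀^∞ exp (-t s) dt = 1 / s`; it includes `s = 0`, where both sides are `∞`, so no
almost-sure positivity is needed when it is applied to a random `s`. -/
theorem lintegral_Ioi_exp_neg_mul {s : ℝ} (hs : 0 ≤ s) :
    ∫⁻ t in Set.Ioi (0 : ℝ), ENNReal.ofReal (Real.exp (-(t * s))) = (ENNReal.ofReal s)⁻¹ := by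
  rcases hs.eq_or_lt with rfl | hs
  · simp
  have hint : IntegrableOn (fun t => Real.exp (-(t * s))) (Set.Ioi 0) := by
    have := integrableOn_exp_mul_Ioi (a := -s) (by linarith) 0
    simpa [mul_comm] using this
  rw [← ofReal_integral_eq_lintegral_ofReal hint (ae_of_all _ fun x => (Real.exp_pos _).le),
    ← ENNReal.ofReal_inv_of_pos hs]
  congr 1
  have := integral_exp_mul_Ioi (a := -s) (by linarith) 0
  simpa [mul_comm] using this

theorem lintegral_Ioi_one_add_mul_rpow {a c : ℝ} (ha : 0 < a) (hc : 1 < c) :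
    ∫⁻ t in Set.Ioi (0 : ℝ), ENNReal.ofReal ((1 + a * t) ^ (-c)) =
      ENNReal.ofReal (1 / (a * (c - 1))) := by
  have hderiv : ∀ t ∈ Set.Ici (0 : ℝ),
      HasDerivAt (fun t => -((1 + a * t) ^ (1 - c) / (a * (c - 1)))) ((1 + a * t) ^ (-c)) t := by
    intro t ht
    have ht' : (0 : ℝ) ≤ t := ht
    have hpos : 0 < 1 + a * t := by positivity
    have h1 : HasDerivAt (fun t => 1 + a * t) a t := by
      simpa using ((hasDerivAt_id t).const_mul a).const_add 1
    have h2 := ((h1.rpow_const (p := 1 - c) (Or.inl hpos.ne')).div_const (a * (c - 1))).neg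
    refine h2.congr_deriv ?_
    rw [show 1 - c - 1 = -c by ring]
    have : c - 1 ≠ 0 := by linarith
    field_simp
    ring
  have hnn : ∀ t ∈ Set.Ioi (0 : ℝ), 0 ≤ (1 + a * t) ^ (-c) := fun t ht => by
    have ht' : (0 : ℝ) < t := ht
    positivity
  have hlim : Filter.Tendsto (fun t => -((1 + a * t) ^ (1 - c) / (a * (c - 1)))) Filter.atTop
      (nhds (-(0 / (a * (c - 1))))) := by
    refine (Filter.Tendsto.div_const ?_ _).neg
    have h1 : Filter.Tendsto (fun t => 1 + a * t) Filter.atTop Filter.atTop :=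
      Filter.tendsto_atTop_add_const_left _ _ (Filter.tendsto_id.const_mul_atTop ha)
    have h2 := (tendsto_rpow_neg_atTop (y := c - 1) (by linarith)).comp h1
    simpa [Function.comp_def] using h2
  have hint := integrableOn_Ioi_deriv_of_nonneg' hderiv hnn hlim
  rw [← ofReal_integral_eq_lintegral_ofReal hint
    ((ae_restrict_iff' measurableSet_Ioi).2 (ae_of_all _ hnn)),
    integral_Ioi_of_hasDerivAt_of_nonneg' hderiv hnn hlim]
  simp

/-- The inverse moment of a scaled chi-squared variable: since `1 / s = ∫₀^∞ exp (-t s) dt`, it is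
the integral over `t > 0` of the Laplace transform `(1 + 2 v t) ^ (-k / 2)`, with `k` the number of
degrees of freedom. -/
theorem lintegral_inv_norm_sq_isoGaussian {ι : Type*} [Fintype ι] {v : ℝ≥0} (hv : v ≠ 0)
    (hι : 2 < Fintype.card ι) :
    ∫⁻ x, (ENNReal.ofReal (‖x‖ ^ 2))⁻¹ ∂(isoGaussian ι v) =
      ENNReal.ofReal (1 / (v * (Fintype.card ι - 2))) := by
  have hv' : (0 : ℝ) < v := by positivity
  have hι' : (2 : ℝ) < Fintype.card ι := by exact_mod_cast hι
  simp_rw [← lintegral_Ioi_exp_neg_mul (sq_nonneg _)]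
  rw [lintegral_lintegral_swap (by fun_prop), setLIntegral_congr_fun measurableSet_Ioi
    fun t ht => lintegral_exp_neg_mul_norm_sq_isoGaussian hv (le_of_lt ht),
    lintegral_Ioi_one_add_mul_rpow (by positivity) (by linarith)]
  congr 2
  ring

/-- The inverse moment of the squared distance of an isotropic Gaussian vector to a subspace: in an
orthonormal basis of the orthogonal complement, the projected vector is again isotropic Gaussian.
Codimension at least three is what makes the inverse moment finite. -/
theorem lintegral_inv_norm_sq_orthogonal_starProjection {ι : Type*} [Fintype ι] {v : ℝ≥0}
    (hv : v ≠ 0) (W : Submodule ℝ (EuclideanSpace ℝ ι))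
    (hW : Module.finrank ℝ W + 2 < Fintype.card ι) :
    ∫⁻ x, (ENNReal.ofReal (‖Wᗮ.starProjection x‖ ^ 2))⁻¹ ∂(isoGaussian ι v) =
      ENNReal.ofReal (1 / (v * (Fintype.card ι - Module.finrank ℝ W - 2))) := by
  let e := stdOrthonormalBasis ℝ Wᗮ
  have hdim : Module.finrank ℝ W + Module.finrank ℝ Wᗮ = Fintype.card ι := by
    rw [W.finrank_add_finrank_orthogonal, finrank_euclideanSpace]
  have he : Orthonormal ℝ fun i => (e i : EuclideanSpace ℝ ι) :=
    e.orthonormal.comp_linearIsometry Wᗮ.subtypeₗᵢ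
  -- The projection has the same norm as the vector of coordinates along the basis `e` of `Wᗮ`.
  have hnorm : ∀ x : EuclideanSpace ℝ ι, ‖Wᗮ.starProjection x‖ ^ 2 =
      ‖(WithLp.toLp 2 fun i => inner ℝ (e i : EuclideanSpace ℝ ι) x : EuclideanSpace ℝ _)‖ ^ 2 := by
    intro x
    rw [Submodule.starProjection_apply, Submodule.norm_coe, ← e.sum_sq_inner_right,
      EuclideanSpace.real_norm_sq_eq]
    refine Finset.sum_congr rfl fun i _ => ?_
    rw [Submodule.inner_orthogonalProjectionOnto_eq_of_mem_left]
  simp_rw [hnorm]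
  rw [(hasLaw_inner_orthonormal (v := v) he).lintegral_comp
    (f := fun y => (ENNReal.ofReal (‖y‖ ^ 2))⁻¹) (by fun_prop),
    lintegral_inv_norm_sq_isoGaussian hv (by simp; omega)]
  congr 3
  rw [← hdim]
  push_cast
  simp

/-- An isotropic Gaussian vector almost surely avoids any given proper subspace. -/
theorem ae_notMem_isoGaussian {ι : Type*} [Fintype ι] {v : ℝ≥0} (hv : v ≠ 0)
    {W : Submodule ℝ (EuclideanSpace ℝ ι)} (hW : W ≠ ⊤) :
    ∀ᵐ x ∂(isoGaussian ι v), x ∉ W := by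
  have hW' : Wᗮ ≠ ⊥ := by rwa [Ne, Submodule.orthogonal_eq_bot_iff]
  obtain ⟨z, hz, hz0⟩ := Submodule.exists_mem_ne_zero_of_ne_bot hW'
  have hu : ‖‖z‖⁻¹ • z‖ = 1 := norm_smul_inv_norm (𝕜 := ℝ) hz0
  have hne : ∀ᵐ y ∂(gaussianReal 0 v), y ≠ 0 := by
    have := nullSingletonClass_gaussianReal (μ := 0) hv
    simp [ae_iff]
  rw [← (hasLaw_inner_unit (v := v) hu).map_eq] at hne
  filter_upwards [ae_of_ae_map (hasLaw_inner_unit hu).aemeasurable hne] with x hx hxW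
  exact hx ((Submodule.mem_orthogonal' _ _).1 (Wᗮ.smul_mem _ hz) x hxW)

end InverseMoment

/-! ### Least-norm solutions in closed form -/

section LeastNorm

variable {n m : ℕ}

/-- The closed form `Mᵀ (M Mᵀ)⁻¹ b` of the least-norm solution for `M` of full row rank. Unlike
`leastNormSolution`, which is a choice, it is visibly measurable in `M`. -/
noncomputable def normalSolution (M : Matrix (Fin n) (Fin m) ℝ) (b : Fin n → ℝ) :
    EuclideanSpace ℝ (Fin m) :=
  WithLp.toLp 2 (Mᵀ *ᵥ ((M * Mᵀ)⁻¹ *ᵥ b))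

theorem IsLeastNormSolution.leastNormSolution_eq {M : Matrix (Fin n) (Fin m) ℝ} {b : Fin n → ℝ}
    {x : EuclideanSpace ℝ (Fin m)} (hx : IsLeastNormSolution M b x) :
    leastNormSolution M b = x :=
  (existsUnique_isLeastNormSolution M b ⟨_, hx.1⟩).unique (leastNormSolution_spec ⟨_, hx.1⟩) hx

/-- A solution orthogonal to the kernel has least norm. -/
theorem IsLeastNormSolution.of_inner_eq {M : Matrix (Fin n) (Fin m) ℝ} {b : Fin n → ℝ}
    {x : EuclideanSpace ℝ (Fin m)} (hx : M *ᵥ x.ofLp = b)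
    (h : ∀ y : EuclideanSpace ℝ (Fin m), M *ᵥ y.ofLp = b → inner ℝ x y = inner ℝ x x) :
    IsLeastNormSolution M b x := by
  refine ⟨hx, fun y hy => ?_⟩
  have h1 := h y hy
  have h2 : ‖x - y‖ ^ 2 = ‖x‖ ^ 2 - 2 * inner ℝ x y + ‖y‖ ^ 2 := norm_sub_sq_real x y
  rw [h1, real_inner_self_eq_norm_sq] at h2
  unfold cost
  nlinarith [sq_nonneg ‖x - y‖]

/-- The least-norm solution is orthogonal to the kernel: otherwise moving along the kernel would
decrease the norm. -/
theorem IsLeastNormSolution.inner_eq_zero {M : Matrix (Fin n) (Fin m) ℝ} {b : Fin n → ℝ}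
    {x : EuclideanSpace ℝ (Fin m)} (hx : IsLeastNormSolution M b x)
    {y : EuclideanSpace ℝ (Fin m)} (hy : M *ᵥ y.ofLp = 0) : inner ℝ x y = 0 := by
  have h1 : ∀ s : ℝ, 0 ≤ 2 * s * inner ℝ x y + s ^ 2 * ‖y‖ ^ 2 := by
    intro s
    have h2 := hx.2 (x + s • y) (by
      rw [WithLp.ofLp_add, WithLp.ofLp_smul, Matrix.mulVec_add, Matrix.mulVec_smul, hy, hx.1]
      simp)
    unfold cost at h2
    rw [norm_add_sq_real, norm_smul, mul_pow, Real.norm_eq_abs, sq_abs, inner_smul_right] at h2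
    linarith
  rcases eq_or_ne y 0 with rfl | hy0
  · simp
  have hpos : 0 < ‖y‖ ^ 2 := by positivity
  -- This step size minimizes the quadratic `s ↦ ‖x + s • y‖ ^ 2`.
  have h3 := h1 (-inner ℝ x y / ‖y‖ ^ 2)
  have h4 : 2 * (-inner ℝ x y / ‖y‖ ^ 2) * inner ℝ x y + (-inner ℝ x y / ‖y‖ ^ 2) ^ 2 * ‖y‖ ^ 2
      = -(inner ℝ x y ^ 2 / ‖y‖ ^ 2) := by
    field_simp
    ring
  rw [h4] at h3
  have h5 : (inner ℝ x y : ℝ) ^ 2 / ‖y‖ ^ 2 ≤ 0 := by linarith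
  have h6 : (inner ℝ x y : ℝ) ^ 2 ≤ 0 := by
    rwa [div_le_iff₀ hpos, zero_mul] at h5
  exact pow_eq_zero_iff two_ne_zero |>.1 (le_antisymm h6 (sq_nonneg _))

theorem isLeastNormSolution_normalSolution {M : Matrix (Fin n) (Fin m) ℝ}
    (hM : LinearIndependent ℝ M.row) (b : Fin n → ℝ) :
    IsLeastNormSolution M b (normalSolution M b) := by
  have hpd : (M * Mᵀ).PosDef := by
    simpa using Matrix.PosDef.mul_conjTranspose_self M (Matrix.vecMul_injective_iff.2 hM)
  have hunit : IsUnit (M * Mᵀ).det := (Matrix.isUnit_iff_isUnit_det _).1 hpd.isUnit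
  have hsol : M *ᵥ (normalSolution M b).ofLp = b := by
    rw [normalSolution, Matrix.mulVec_mulVec, Matrix.mulVec_mulVec, Matrix.mul_nonsing_inv _ hunit,
      Matrix.one_mulVec]
  have hinner : ∀ y : EuclideanSpace ℝ (Fin m), inner ℝ (normalSolution M b) y =
      ((M * Mᵀ)⁻¹ *ᵥ b) ⬝ᵥ (M *ᵥ y.ofLp) := by
    intro y
    rw [EuclideanSpace.inner_eq_star_dotProduct, normalSolution, dotProduct_comm]
    simp only [star_trivial]
    rw [Matrix.dotProduct_mulVec, Matrix.mulVec_transpose]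
  refine .of_inner_eq hsol fun y hy => ?_
  rw [hinner, hinner, hy, hsol]

theorem leastNormSolution_eq_normalSolution {M : Matrix (Fin n) (Fin m) ℝ}
    (hM : LinearIndependent ℝ M.row) (b : Fin n → ℝ) :
    leastNormSolution M b = normalSolution M b :=
  IsLeastNormSolution.leastNormSolution_eq (isLeastNormSolution_normalSolution hM b)

/-- The matrix whose first row is `q.1` and whose other rows are `q.2`. -/
def consMatrix (q : EuclideanSpace ℝ (Fin m) × (Fin n → EuclideanSpace ℝ (Fin m))) :
    Matrix (Fin (n + 1)) (Fin m) ℝ :=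
  Matrix.of fun i => (Fin.cons q.1 q.2 : Fin (n + 1) → EuclideanSpace ℝ (Fin m)) i

theorem consMatrix_mulVec (q : EuclideanSpace ℝ (Fin m) × (Fin n → EuclideanSpace ℝ (Fin m)))
    (z : EuclideanSpace ℝ (Fin m)) :
    consMatrix q *ᵥ z.ofLp = Fin.cons (inner ℝ q.1 z) fun i => inner ℝ (q.2 i) z := by
  ext i
  refine Fin.cases ?_ (fun i => ?_) i <;>
  simp [consMatrix, Matrix.mulVec, dotProduct, PiLp.inner_apply, mul_comm]

theorem linearIndependent_row_consMatrix
    {q : EuclideanSpace ℝ (Fin m) × (Fin n → EuclideanSpace ℝ (Fin m))} :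
    LinearIndependent ℝ (consMatrix q).row ↔
      LinearIndependent ℝ (Fin.cons q.1 q.2 : Fin (n + 1) → EuclideanSpace ℝ (Fin m)) := by
  rw [← LinearMap.linearIndependent_iff (WithLp.linearEquiv 2 ℝ (Fin m → ℝ)).toLinearMap
    (LinearEquiv.ker _)]
  rfl

/-- The least-norm solution of `⟪x, z⟫ = c`, `⟪yᵢ, z⟫ = 0` is a multiple of the component of `x`
orthogonal to all `yᵢ`. -/
theorem norm_sq_leastNormSolution_consMatrix (c : ℝ)
    (q : EuclideanSpace ℝ (Fin m) × (Fin n → EuclideanSpace ℝ (Fin m)))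
    (hq : q.1 ∉ Submodule.span ℝ (Set.range q.2)) :
    ‖leastNormSolution (consMatrix q) (Fin.cons c 0)‖ ^ 2 =
      c ^ 2 / ‖(Submodule.span ℝ (Set.range q.2))ᗮ.starProjection q.1‖ ^ 2 := by
  set W := Submodule.span ℝ (Set.range q.2) with hW
  set p := Wᗮ.starProjection q.1 with hp
  have hpW : p ∈ Wᗮ := Submodule.starProjection_apply_mem _ _
  have hres : q.1 - p ∈ W := by
    have := Wᗮ.sub_starProjection_mem_orthogonal q.1
    rwa [Submodule.orthogonal_orthogonal] at this
  have hp0 : p ≠ 0 := by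
    intro h0
    rw [h0, sub_zero] at hres
    exact hq hres
  have hpp : 0 < ‖p‖ ^ 2 := by positivity
  have hqp : inner ℝ q.1 p = ‖p‖ ^ 2 := by
    have := (Submodule.mem_orthogonal _ _).1 hpW _ hres
    rw [inner_sub_left, real_inner_self_eq_norm_sq] at this
    linarith
  -- The multiple is fixed by `⟪q.1, p⟫ = ‖p‖ ^ 2`.
  have hz : IsLeastNormSolution (consMatrix q) (Fin.cons c 0) ((c / ‖p‖ ^ 2) • p) := by
    refine .of_inner_eq ?_ fun y hy => ?_
    · rw [consMatrix_mulVec]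
      congr 1
      · rw [inner_smul_right, hqp]
        field_simp
      · ext i
        rw [inner_smul_right, (Submodule.mem_orthogonal _ _).1 hpW _
          (Submodule.subset_span ⟨i, rfl⟩)]
        simp
    · rw [consMatrix_mulVec] at hy
      have h0 : inner ℝ q.1 y = c := congrFun hy 0
      have h1 : ∀ i, inner ℝ (q.2 i) y = 0 := fun i => congrFun hy i.succ
      have h2 : ∀ w ∈ W, inner ℝ w y = 0 := by
        intro w hw
        have hle : W ≤ (ℝ ∙ y)ᗮ := Submodule.span_le.2 (by
          rintro _ ⟨i, rfl⟩
          exact Submodule.mem_orthogonal_singleton_iff_inner_left.2 (h1 i))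
        exact Submodule.mem_orthogonal_singleton_iff_inner_left.1 (hle hw)
      have h3 : inner ℝ p y = c := by
        have := h2 _ hres
        rw [inner_sub_left, h0] at this
        linarith
      rw [inner_smul_left, h3, inner_smul_left, inner_smul_right, real_inner_self_eq_norm_sq]
      simp only [conj_trivial]
      field_simp
  rw [hz.leastNormSolution_eq, norm_smul, mul_pow, Real.norm_eq_abs, sq_abs]
  field_simp

theorem continuous_consMatrix :
    Continuous fun q : EuclideanSpace ℝ (Fin m) × (Fin n → EuclideanSpace ℝ (Fin m)) =>
      consMatrix q := by
  refine continuous_matrix fun i j => ?_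
  refine Fin.cases ?_ (fun i => ?_) i
  · change Continuous fun q : EuclideanSpace ℝ (Fin m) × (Fin n → EuclideanSpace ℝ (Fin m)) =>
      q.1 j
    fun_prop
  · change Continuous fun q : EuclideanSpace ℝ (Fin m) × (Fin n → EuclideanSpace ℝ (Fin m)) =>
      q.2 i j
    fun_prop

/-- Measurability of the normal-equation formula along a continuous family of matrices. -/
theorem measurable_normalSolution {X : Type*} [TopologicalSpace X] [MeasurableSpace X]
    [OpensMeasurableSpace X] {M : X → Matrix (Fin n) (Fin m) ℝ} (hM : Continuous M)
    (b : Fin n → ℝ) : Measurable fun x => normalSolution (M x) b := by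
  have hG := hM.matrix_mul hM.matrix_transpose
  have hinv : ∀ i j, Measurable fun x => (M x * (M x)ᵀ)⁻¹ i j := by
    intro i j
    simp only [Matrix.inv_def, Ring.inverse_eq_inv', Matrix.smul_apply, smul_eq_mul]
    exact hG.matrix_det.measurable.inv.mul (hG.matrix_adjugate.matrix_elem i j).measurable
  refine (by fun_prop : Measurable (WithLp.toLp 2 : _ → EuclideanSpace ℝ (Fin m))).comp
    (measurable_pi_lambda _ fun a => ?_)
  simp only [Matrix.mulVec, dotProduct, Matrix.transpose_apply]
  exact Finset.measurable_fun_sum _ fun i _ => (hM.matrix_elem i a).measurable.mul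
    (Finset.measurable_fun_sum _ fun j _ => (hinv i j).mul measurable_const)

end LeastNorm

/-! ### Gaussian systems of equations -/

section GaussianRows

variable {n m : ℕ} {v : ℝ≥0}

/-- Prepending an independent Gaussian vector to fewer than `m` linearly independent vectors almost
surely keeps them independent, since the vector avoids their span. -/
theorem ae_prod_linearIndependent_cons (hv : v ≠ 0) (hnm : n < m)
    {ν : Measure (Fin n → EuclideanSpace ℝ (Fin m))} [SFinite ν]
    (hν : ∀ᵐ y ∂ν, LinearIndependent ℝ y) :
    ∀ᵐ q ∂((isoGaussian (Fin m) v).prod ν),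
      LinearIndependent ℝ (Fin.cons q.1 q.2 : Fin (n + 1) → EuclideanSpace ℝ (Fin m)) := by
  have hcont : Continuous fun q : (Fin n → EuclideanSpace ℝ (Fin m)) × EuclideanSpace ℝ (Fin m) =>
      (Fin.cons q.2 q.1 : Fin (n + 1) → EuclideanSpace ℝ (Fin m)) := by fun_prop
  -- The given vectors are fixed first, so the product is taken in the other order.
  have hswap : ∀ᵐ q ∂(ν.prod (isoGaussian (Fin m) v)),
      LinearIndependent ℝ (Fin.cons q.2 q.1 : Fin (n + 1) → EuclideanSpace ℝ (Fin m)) := by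
    have hopen : IsOpen {q : (Fin n → EuclideanSpace ℝ (Fin m)) × EuclideanSpace ℝ (Fin m) |
        LinearIndependent ℝ (Fin.cons q.2 q.1 : Fin (n + 1) → EuclideanSpace ℝ (Fin m))} :=
      isOpen_setOfPred_linearIndependent.preimage hcont
    rw [Measure.ae_prod_iff_ae_ae hopen.measurableSet]
    filter_upwards [hν] with y hy
    have hW : Submodule.span ℝ (Set.range y) ≠ ⊤ := by
      intro h
      have h1 := finrank_span_eq_card hy
      rw [h, finrank_top, finrank_euclideanSpace] at h1
      simp at h1
      omega
    filter_upwards [ae_notMem_isoGaussian hv hW] with x hx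
    exact linearIndependent_finCons.2 ⟨hy, hx⟩
  rw [← Measure.prod_swap] at hswap
  exact ae_of_ae_map (f := Prod.swap) (p := fun q => LinearIndependent ℝ
    (Fin.cons q.2 q.1 : Fin (n + 1) → EuclideanSpace ℝ (Fin m))) (by fun_prop) hswap

theorem ae_pi_linearIndependent (hv : v ≠ 0) (hnm : n ≤ m) :
    ∀ᵐ y ∂(Measure.pi fun _ : Fin n => isoGaussian (Fin m) v), LinearIndependent ℝ y := by
  induction n with
  | zero => exact ae_of_all _ fun y => linearIndependent_empty_type
  | succ n ih =>
    have h := ae_prod_linearIndependent_cons hv (by omega) (ih (by omega))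
    have hmp := measurePreserving_piFinSuccAbove (fun _ : Fin (n + 1) => isoGaussian (Fin m) v) 0
    filter_upwards [hmp.quasiMeasurePreserving.ae h] with y hy
    convert hy using 1
    exact (Fin.cons_self_tail y).symm

theorem ofReal_norm_sq_normalSolution_consMatrix {x : EuclideanSpace ℝ (Fin m)}
    {y : Fin n → EuclideanSpace ℝ (Fin m)} (hy : LinearIndependent ℝ y)
    (hx : x ∉ Submodule.span ℝ (Set.range y)) (c : ℝ) :
    ENNReal.ofReal (‖normalSolution (consMatrix (x, y)) (Fin.cons c 0)‖ ^ 2) =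
      ENNReal.ofReal (c ^ 2) *
        (ENNReal.ofReal (‖(Submodule.span ℝ (Set.range y))ᗮ.starProjection x‖ ^ 2))⁻¹ := by
  have hLI : LinearIndependent ℝ (consMatrix (x, y)).row :=
    linearIndependent_row_consMatrix.2 (linearIndependent_finCons.2 ⟨hy, hx⟩)
  have hne : (Submodule.span ℝ (Set.range y))ᗮ.starProjection x ≠ 0 := by
    rwa [Ne, Submodule.starProjection_apply_eq_zero_iff, Submodule.orthogonal_orthogonal]
  rw [← leastNormSolution_eq_normalSolution hLI, norm_sq_leastNormSolution_consMatrix c (x, y) hx,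
    div_eq_mul_inv, ENNReal.ofReal_mul (sq_nonneg _), ENNReal.ofReal_inv_of_pos (by positivity)]

theorem lintegral_norm_sq_normalSolution_of_linearIndependent (hv : v ≠ 0) (hnm : n + 2 < m)
    (c : ℝ) {y : Fin n → EuclideanSpace ℝ (Fin m)} (hy : LinearIndependent ℝ y) :
    ∫⁻ x, ENNReal.ofReal (‖normalSolution (consMatrix (x, y)) (Fin.cons c 0)‖ ^ 2)
      ∂(isoGaussian (Fin m) v) = ENNReal.ofReal (c ^ 2 / (v * (m - n - 2))) := by
  have hdim : Module.finrank ℝ (Submodule.span ℝ (Set.range y)) = n := by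
    simpa using finrank_span_eq_card hy
  have hW : Submodule.span ℝ (Set.range y) ≠ ⊤ := by
    intro h
    rw [h, finrank_top, finrank_euclideanSpace, Fintype.card_fin] at hdim
    omega
  have hx := (ae_notMem_isoGaussian hv hW).mono fun x hx =>
    ofReal_norm_sq_normalSolution_consMatrix hy hx c
  rw [lintegral_congr_ae hx, lintegral_const_mul' _ _ ENNReal.ofReal_ne_top,
    lintegral_inv_norm_sq_orthogonal_starProjection hv _ (by rw [hdim]; simpa using hnm),
    ← ENNReal.ofReal_mul (sq_nonneg _), hdim, Fintype.card_fin, mul_one_div]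

/-- The mean squared norm of the least-norm solution of a Gaussian system, an instance of the mean
of an inverse Wishart matrix. Given the rows `q.2`, the squared norm is `c ^ 2` over the squared
distance of `q.1` to their span. -/
theorem lintegral_norm_sq_normalSolution (hv : v ≠ 0) (hnm : n + 2 < m) (c : ℝ) :
    ∫⁻ q, ENNReal.ofReal (‖normalSolution (consMatrix q) (Fin.cons c 0 : Fin (n + 1) → ℝ)‖ ^ 2)
      ∂((isoGaussian (Fin m) v).prod (Measure.pi fun _ : Fin n => isoGaussian (Fin m) v)) =
      ENNReal.ofReal (c ^ 2 / (v * (m - n - 2))) := by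
  have hmeas := measurable_normalSolution (continuous_consMatrix (n := n) (m := m)) (Fin.cons c 0)
  rw [lintegral_prod_symm' _ (by fun_prop)]
  have hinner := (ae_pi_linearIndependent (n := n) (m := m) hv (by omega)).mono fun y hy =>
    lintegral_norm_sq_normalSolution_of_linearIndependent hv hnm c hy
  rw [lintegral_congr_ae hinner]
  simp

end GaussianRows

section InnerMoments

variable {Ω : Type*} [MeasurableSpace Ω] {P : Measure Ω} [IsProbabilityMeasure P]
  {ι : Type*} [Fintype ι] {v : ℝ≥0} {h Z : Ω → EuclideanSpace ℝ ι}

theorem hasLaw_prodMk_of_indepFun (hh : HasLaw h (isoGaussian ι v) P) (hZ : AEMeasurable Z P)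
    (hind : IndepFun h Z P) :
    HasLaw (fun ω => (h ω, Z ω)) ((isoGaussian ι v).prod (P.map Z)) P :=
  IndepFun.hasLaw_prod hh ⟨hZ, rfl⟩ hind

/-- Conditionally on `Z`, the variable `⟪Z, h⟫` is centred of variance `v ‖Z‖ ^ 2`. -/
theorem integrable_inner_sq_and_integral (hh : HasLaw h (isoGaussian ι v) P)
    (hZ : AEMeasurable Z P) (hind : IndepFun h Z P) (hint : Integrable (fun ω => ‖Z ω‖ ^ 2) P) :
    Integrable (fun ω => (inner ℝ (Z ω) (h ω) : ℝ) ^ 2) P ∧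
    ∫ ω, (inner ℝ (Z ω) (h ω) : ℝ) ^ 2 ∂P = v * ∫ ω, ‖Z ω‖ ^ 2 ∂P := by
  have hlaw := hasLaw_prodMk_of_indepFun hh hZ hind
  have := Measure.isProbabilityMeasure_map hZ
  have hintZ : Integrable (fun z => ‖z‖ ^ 2) (P.map Z) := by
    rw [integrable_map_measure (by fun_prop) hZ]
    exact hint
  have hprod : Integrable (fun q : EuclideanSpace ℝ ι × EuclideanSpace ℝ ι =>
      (inner ℝ q.2 q.1 : ℝ) ^ 2) ((isoGaussian ι v).prod (P.map Z)) := by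
    rw [integrable_prod_iff' (by fun_prop)]
    refine ⟨ae_of_all _ fun z => (memLp_inner_isoGaussian z).integrable_sq, ?_⟩
    simp_rw [norm_pow, Real.norm_eq_abs, sq_abs, integral_inner_sq_isoGaussian]
    exact hintZ.const_mul _
  constructor
  · rw [← hlaw.map_eq] at hprod
    exact hprod.comp_aemeasurable hlaw.aemeasurable
  · have h1 := hlaw.integral_comp (f := fun q => (inner ℝ q.2 q.1 : ℝ) ^ 2) (by fun_prop)
    simp only [Function.comp_def] at h1
    rw [h1, integral_prod_symm _ hprod]
    simp_rw [integral_inner_sq_isoGaussian]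
    rw [integral_const_mul, integral_map hZ (by fun_prop)]

theorem memLp_inner (hh : HasLaw h (isoGaussian ι v) P)
    (hZ : AEMeasurable Z P) (hind : IndepFun h Z P) (hint : Integrable (fun ω => ‖Z ω‖ ^ 2) P) :
    MemLp (fun ω => (inner ℝ (Z ω) (h ω) : ℝ)) 2 P := by
  have := hh.aemeasurable
  rw [memLp_two_iff_integrable_sq (by fun_prop)]
  exact (integrable_inner_sq_and_integral hh hZ hind hint).1

theorem integral_inner_eq_zero (hh : HasLaw h (isoGaussian ι v) P)
    (hZ : AEMeasurable Z P) (hind : IndepFun h Z P) (hint : Integrable (fun ω => ‖Z ω‖ ^ 2) P) :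
    ∫ ω, (inner ℝ (Z ω) (h ω) : ℝ) ∂P = 0 := by
  have hlaw := hasLaw_prodMk_of_indepFun hh hZ hind
  have := Measure.isProbabilityMeasure_map hZ
  have h1 := hlaw.integral_comp (f := fun q => (inner ℝ q.2 q.1 : ℝ)) (by fun_prop)
  have hprod : Integrable (fun q : EuclideanSpace ℝ ι × EuclideanSpace ℝ ι =>
      (inner ℝ q.2 q.1 : ℝ)) ((isoGaussian ι v).prod (P.map Z)) := by
    rw [← hlaw.map_eq, integrable_map_measure (by fun_prop) hlaw.aemeasurable]
    exact (memLp_inner hh hZ hind hint).integrable (by norm_num)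
  simp only [Function.comp_def] at h1
  rw [h1, integral_prod_symm _ hprod]
  simp_rw [integral_inner_isoGaussian]
  simp

end InnerMoments

/-! ### The sketched problem in an adapted orthonormal frame -/

section AdaptedFrame

theorem exists_mulVec_eq_of_rank_eq {n d : ℕ} {A : Matrix (Fin n) (Fin d) ℝ} (hA : A.rank = n)
    (b : Fin n → ℝ) : ∃ v, A *ᵥ v = b := by
  have h : LinearMap.range A.mulVecLin = ⊤ :=
    Submodule.eq_top_of_finrank_eq (by rw [← Matrix.rank, hA]; simp)
  exact LinearMap.range_eq_top.1 h b

/-- The kernel of a matrix as a subspace of Euclidean space. -/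
def kernel {n d : ℕ} (A : Matrix (Fin n) (Fin d) ℝ) : Submodule ℝ (EuclideanSpace ℝ (Fin d)) :=
  LinearMap.ker (A.mulVecLin ∘ₗ (WithLp.linearEquiv 2 ℝ (Fin d → ℝ)).toLinearMap)

theorem mem_kernel {n d : ℕ} {A : Matrix (Fin n) (Fin d) ℝ} {x : EuclideanSpace ℝ (Fin d)} :
    x ∈ kernel A ↔ A *ᵥ x.ofLp = 0 := Iff.rfl

theorem finrank_kernel {n d : ℕ} (A : Matrix (Fin n) (Fin d) ℝ) :
    A.rank + Module.finrank ℝ (kernel A) = d := by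
  have h := LinearMap.finrank_range_add_finrank_ker
    (A.mulVecLin ∘ₗ (WithLp.linearEquiv 2 ℝ (Fin d → ℝ)).toLinearMap)
  rw [LinearMap.range_comp_of_range_eq_top _ (LinearEquiv.range _), finrank_euclideanSpace,
    Fintype.card_fin] at h
  exact h

/-- An orthonormal basis of `ℝᵈ` adapted to the least-norm problem with solution `s`: `w 0` is the
direction of `s`, the other `w i` complete it to a basis of the row space of `A`, and `e` is a basis
of the kernel of `A`. -/
theorem exists_adapted_orthonormal {N d : ℕ} {A : Matrix (Fin (N + 1)) (Fin d) ℝ}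
    (hA : A.rank = N + 1) {b : Fin (N + 1) → ℝ} {s : EuclideanSpace ℝ (Fin d)}
    (hs : IsLeastNormSolution A b s) (hs0 : s ≠ 0) :
    ∃ (w : Fin (N + 1) → EuclideanSpace ℝ (Fin d))
      (e : Fin (d - (N + 1)) → EuclideanSpace ℝ (Fin d)),
      Orthonormal ℝ (Sum.elim w e) ∧
      (∀ x : EuclideanSpace ℝ (Fin d), A *ᵥ x.ofLp = b ↔
        inner ℝ (w 0) x = ‖s‖ ∧ ∀ i : Fin N, inner ℝ (w i.succ) x = 0) ∧
      ∀ x : EuclideanSpace ℝ (Fin d), A *ᵥ x.ofLp = b →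
        ‖x‖ ^ 2 = ‖s‖ ^ 2 + ∑ j, (inner ℝ (e j) x : ℝ) ^ 2 := by
  set K := kernel A with hK
  have hsK : ∀ y ∈ K, inner ℝ s y = 0 := fun y hy => hs.inner_eq_zero hy
  have hns : ‖s‖ ≠ 0 := norm_ne_zero_iff.2 hs0
  set R := (K ⊔ ℝ ∙ s)ᗮ with hR
  have hKdim : Module.finrank ℝ K = d - (N + 1) := by
    have : A.rank + Module.finrank ℝ K = d := finrank_kernel A
    omega
  -- `s` is orthogonal to `K`, so `K ⊔ ℝ ∙ s` has dimension `d - N` and its complement `N`.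
  have hRdim : Module.finrank ℝ R = N := by
    have h1 := Submodule.finrank_sup_add_finrank_inf_eq K (ℝ ∙ s)
    have h2 : K ⊓ (ℝ ∙ s) = ⊥ := by
      rw [eq_bot_iff]
      rintro x ⟨hxK, hxs⟩
      obtain ⟨a, rfl⟩ := Submodule.mem_span_singleton.1 hxs
      have h3 := hsK _ hxK
      rw [inner_smul_right, real_inner_self_eq_norm_sq] at h3
      have h4 : a = 0 := by simpa [hns] using h3
      simp [h4]
    rw [h2, finrank_bot, finrank_span_singleton hs0] at h1
    have h5 := (K ⊔ ℝ ∙ s).finrank_add_finrank_orthogonal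
    rw [finrank_euclideanSpace, Fintype.card_fin, ← hR] at h5
    have : A.rank + Module.finrank ℝ K = d := finrank_kernel A
    omega
  let eK := (stdOrthonormalBasis ℝ K).reindex (finCongr hKdim)
  let eR := (stdOrthonormalBasis ℝ R).reindex (finCongr hRdim)
  have hKR : ∀ {x y}, x ∈ K → y ∈ R → inner ℝ x y = 0 := fun hx hy =>
    (Submodule.mem_orthogonal _ _).1 hy _ (Submodule.mem_sup_left hx)
  have hsR : ∀ {y}, y ∈ R → inner ℝ s y = 0 := fun hy =>
    (Submodule.mem_orthogonal _ _).1 hy _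
      (Submodule.mem_sup_right (Submodule.mem_span_singleton_self s))
  refine ⟨Fin.cons (‖s‖⁻¹ • s) fun i => (eR i : EuclideanSpace ℝ (Fin d)), fun j => eK j,
    ⟨?_, ?_⟩, fun x => ?_, fun x hx => ?_⟩
  · rintro (i | j)
    · refine Fin.cases ?_ (fun i => ?_) i
      · exact norm_smul_inv_norm (𝕜 := ℝ) hs0
      · exact eR.orthonormal.1 i
    · exact eK.orthonormal.1 j
  · have hRR : ∀ i i', i ≠ i' →
        inner ℝ (eR i : EuclideanSpace ℝ (Fin d)) (eR i') = 0 := fun i i' h =>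
      eR.orthonormal.2 h
    have hKK : ∀ i i', i ≠ i' →
        inner ℝ (eK i : EuclideanSpace ℝ (Fin d)) (eK i') = 0 := fun i i' h =>
      eK.orthonormal.2 h
    have hmix : ∀ i j, inner ℝ ((Fin.cons (‖s‖⁻¹ • s) fun i => (eR i : EuclideanSpace ℝ (Fin d)) :
        Fin (N + 1) → EuclideanSpace ℝ (Fin d)) i) (eK j : EuclideanSpace ℝ (Fin d)) = 0 := by
      intro i j
      refine Fin.cases ?_ (fun i => ?_) i
      · simp [inner_smul_left, hsK _ (eK j).2]
      · rw [Fin.cons_succ, real_inner_comm]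
        exact hKR (eK j).2 (eR i).2
    rintro (i | j) (i' | j') hne
    · simp only [Sum.elim_inl]
      induction i using Fin.cases with
      | zero =>
        induction i' using Fin.cases with
        | zero => exact (hne rfl).elim
        | succ i' => simp [inner_smul_left, hsR (eR i').2]
      | succ i =>
        induction i' using Fin.cases with
        | zero => rw [real_inner_comm]; simp [inner_smul_left, hsR (eR i).2]
        | succ i' => exact hRR i i' fun h => hne (by rw [h])
    · exact hmix i j'
    · rw [real_inner_comm]
      exact hmix i' j
    · exact hKK j j' fun h => hne (by rw [h])
  · have hsub : A *ᵥ x.ofLp = b ↔ x - s ∈ K := by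
      rw [mem_kernel, WithLp.ofLp_sub, Matrix.mulVec_sub, hs.1, sub_eq_zero]
    rw [hsub]
    simp only [Fin.cons_zero, Fin.cons_succ, inner_smul_left, conj_trivial]
    constructor
    · intro hx
      have h1 := hsK _ hx
      rw [inner_sub_right, real_inner_self_eq_norm_sq] at h1
      refine ⟨?_, fun i => ?_⟩
      · rw [show inner ℝ s x = ‖s‖ ^ 2 by linarith]
        field_simp
      · have h2 := hKR hx (eR i).2
        rw [inner_sub_left, hsR (eR i).2, sub_zero] at h2
        rw [real_inner_comm]
        exact h2
    · rintro ⟨h0, h1⟩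
      have hsx : inner ℝ s (x - s) = 0 := by
        rw [inner_sub_right, real_inner_self_eq_norm_sq]
        field_simp at h0
        linarith
      -- `x - s` lies in `Rᗮ = K ⊔ ℝ ∙ s`, and being orthogonal to `s` it lies in `K`.
      have hmem : x - s ∈ Rᗮ := by
        rw [Submodule.mem_orthogonal]
        intro y hy
        have h2 : (⟨y, hy⟩ : R) = ∑ i, inner ℝ (eR i) ⟨y, hy⟩ • eR i := (eR.sum_repr' _).symm
        have h3 : y = ∑ i, inner ℝ (eR i) ⟨y, hy⟩ • (eR i : EuclideanSpace ℝ (Fin d)) := by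
          simpa using congrArg (Subtype.val) h2
        rw [h3, sum_inner]
        refine Finset.sum_eq_zero fun i _ => ?_
        rw [inner_smul_left, inner_sub_right, h1, real_inner_comm s, hsR (eR i).2]
        simp
      rw [hR, Submodule.orthogonal_orthogonal] at hmem
      obtain ⟨k, hk, z, hz, hkz⟩ := Submodule.mem_sup.1 hmem
      obtain ⟨a, rfl⟩ := Submodule.mem_span_singleton.1 hz
      rw [← hkz, inner_add_right, hsK k hk, inner_smul_right, real_inner_self_eq_norm_sq] at hsx
      have ha : a = 0 := by simpa [hns] using hsx
      rw [← hkz, ha]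
      simpa using hk
  · have hxs : x - s ∈ K := by
      rw [mem_kernel, WithLp.ofLp_sub, Matrix.mulVec_sub, hs.1, hx, sub_self]
    have h1 : ‖x‖ ^ 2 = ‖s‖ ^ 2 + ‖x - s‖ ^ 2 := by
      have h2 := norm_add_sq_real s (x - s)
      rw [hsK _ hxs, add_sub_cancel] at h2
      linarith
    rw [h1]
    congr 1
    have h3 := eK.sum_sq_inner_right ⟨x - s, hxs⟩
    rw [show ‖x - s‖ = ‖(⟨x - s, hxs⟩ : K)‖ from rfl, ← h3]
    refine Finset.sum_congr rfl fun j _ => ?_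
    rw [Submodule.coe_inner, inner_sub_right, real_inner_comm s, hsK _ (eK j).2, sub_zero]

end AdaptedFrame

section SingleSketch

variable {N d m : ℕ}

/-- The pair formed by the first vector `S w₀` and the family of the remaining vectors `S wᵢ`. -/
def sketchRows (w : Fin (N + 1) → EuclideanSpace ℝ (Fin d)) (S : Matrix (Fin m) (Fin d) ℝ) :
    EuclideanSpace ℝ (Fin m) × (Fin N → EuclideanSpace ℝ (Fin m)) :=
  (WithLp.toLp 2 (S *ᵥ (w 0).ofLp), fun i => WithLp.toLp 2 (S *ᵥ (w i.succ).ofLp))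

/-- The least-norm solution of the sketched system, in closed form in the frame `w`. -/
noncomputable def sketchSolution (w : Fin (N + 1) → EuclideanSpace ℝ (Fin d)) (c : ℝ)
    (S : Matrix (Fin m) (Fin d) ℝ) : EuclideanSpace ℝ (Fin m) :=
  normalSolution (consMatrix (sketchRows w S)) (Fin.cons c 0)

/-- The coordinate along `e` of the right-sketch estimator, in closed form in the frame `w`. -/
noncomputable def sketchCoord (w : Fin (N + 1) → EuclideanSpace ℝ (Fin d)) (c : ℝ)
    (e : EuclideanSpace ℝ (Fin d)) (S : Matrix (Fin m) (Fin d) ℝ) : ℝ :=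
  inner ℝ (sketchSolution w c S) (WithLp.toLp 2 (S *ᵥ e.ofLp) : EuclideanSpace ℝ (Fin m))

theorem inner_transpose_mulVec (S : Matrix (Fin m) (Fin d) ℝ) (x : EuclideanSpace ℝ (Fin d))
    (z : EuclideanSpace ℝ (Fin m)) :
    inner ℝ x (WithLp.toLp 2 (Sᵀ *ᵥ z.ofLp) : EuclideanSpace ℝ (Fin d)) =
      inner ℝ (WithLp.toLp 2 (S *ᵥ x.ofLp) : EuclideanSpace ℝ (Fin m)) z := by
  rw [EuclideanSpace.inner_eq_star_dotProduct, EuclideanSpace.inner_eq_star_dotProduct]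
  simp only [star_trivial]
  rw [Matrix.mulVec_transpose, ← Matrix.dotProduct_mulVec]

theorem measurable_sketchCoord (w : Fin (N + 1) → EuclideanSpace ℝ (Fin d)) (c : ℝ)
    (e : EuclideanSpace ℝ (Fin d)) :
    Measurable fun S : Fin m → Fin d → ℝ => sketchCoord w c e (Matrix.of S) := by
  have hmul : ∀ x : EuclideanSpace ℝ (Fin d), Continuous fun S : Fin m → Fin d → ℝ =>
      (WithLp.toLp 2 (Matrix.of S *ᵥ x.ofLp) : EuclideanSpace ℝ (Fin m)) := by
    intro x
    refine (PiLp.continuous_toLp 2 _).comp (continuous_pi fun a => ?_)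
    simp only [Matrix.mulVec, dotProduct, Matrix.of_apply]
    fun_prop
  have hrows : Continuous fun S : Fin m → Fin d → ℝ => sketchRows w (Matrix.of S) :=
    (hmul _).prodMk (continuous_pi fun i => hmul _)
  exact (measurable_normalSolution (continuous_consMatrix.comp hrows) _).inner (hmul e).measurable

/-- The sketched problem has the constraints of the system with rows `S wᵢ`, because
`⟪wᵢ, Sᵀ z⟫ = ⟪S wᵢ, z⟫`. -/
theorem isLeastNormSolution_sketched_iff {n : ℕ} {A : Matrix (Fin n) (Fin d) ℝ}
    {b : Fin n → ℝ} {w : Fin (N + 1) → EuclideanSpace ℝ (Fin d)} {c : ℝ}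
    (hw : ∀ x : EuclideanSpace ℝ (Fin d), A *ᵥ x.ofLp = b ↔
      inner ℝ (w 0) x = c ∧ ∀ i : Fin N, inner ℝ (w i.succ) x = 0)
    (S : Matrix (Fin m) (Fin d) ℝ) (z : EuclideanSpace ℝ (Fin m)) :
    IsLeastNormSolution (A * Sᵀ) b z ↔
      IsLeastNormSolution (consMatrix (sketchRows w S)) (Fin.cons c 0) z := by
  have h : ∀ z : EuclideanSpace ℝ (Fin m), (A * Sᵀ) *ᵥ z.ofLp = b ↔
      consMatrix (sketchRows w S) *ᵥ z.ofLp = Fin.cons c 0 := by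
    intro z
    have h1 := hw (WithLp.toLp 2 (Sᵀ *ᵥ z.ofLp))
    rw [← Matrix.mulVec_mulVec, consMatrix_mulVec, Fin.cons_inj]
    simp only [inner_transpose_mulVec] at h1
    rw [h1]
    simp [sketchRows, funext_iff]
  unfold IsLeastNormSolution
  simp_rw [h]

theorem indepFun_inr_inl {Ω ι₁ ι₂ E : Type*} [MeasurableSpace Ω] {P : Measure Ω}
    [Fintype ι₁] [MeasurableSpace E]
    {X : ι₁ ⊕ ι₂ → Ω → E} (hX : iIndepFun X P) (hm : ∀ i, AEMeasurable (X i) P) (j : ι₂) :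
    IndepFun (X (Sum.inr j)) (fun ω i => X (Sum.inl i) ω) P := by
  classical
  let T : Finset (ι₁ ⊕ ι₂) := Finset.univ.image Sum.inl
  have hT : ∀ i, Sum.inl i ∈ T := fun i => Finset.mem_image_of_mem _ (Finset.mem_univ i)
  have h := hX.indepFun_finset₀ {Sum.inr j} T (by simp [T]) hm
  let φ : (({Sum.inr j} : Finset (ι₁ ⊕ ι₂)) → E) → E := fun g =>
    g ⟨Sum.inr j, Finset.mem_singleton_self _⟩
  let ψ : (T → E) → ι₁ → E := fun g i => g ⟨Sum.inl i, hT i⟩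
  have hφ : Measurable φ := measurable_pi_apply _
  have hψ : Measurable ψ := measurable_pi_lambda _ fun i => measurable_pi_apply _
  exact h.comp hφ hψ

variable {Ω : Type*} [MeasurableSpace Ω] {P : Measure Ω} [IsProbabilityMeasure P]
  {S : Ω → Matrix (Fin m) (Fin d) ℝ} {w : Fin (N + 1) → EuclideanSpace ℝ (Fin d)}
  {κ : Type*} [Fintype κ] {e : κ → EuclideanSpace ℝ (Fin d)}

theorem IsGaussianSketch.hasLaw_sketchRows (hS : IsGaussianSketch P S) (hw : Orthonormal ℝ w) :
    HasLaw (fun ω => sketchRows w (S ω)) ((isoGaussian (Fin m) (m : ℝ≥0)⁻¹).prod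
      (Measure.pi fun _ : Fin N => isoGaussian (Fin m) (m : ℝ≥0)⁻¹)) P := by
  have h1 := (hS.iIndepFun_mulVec hw).hasLaw_pi fun j => hS.hasLaw_mulVec (hw.1 j)
  exact (measurePreserving_piFinSuccAbove
    (fun _ : Fin (N + 1) => isoGaussian (Fin m) (m : ℝ≥0)⁻¹) 0).hasLaw.fun_comp h1

theorem IsGaussianSketch.ae_isLeastNormSolution (hS : IsGaussianSketch P S)
    (hw : Orthonormal ℝ w) (hNm : N < m) (c : ℝ) :
    ∀ᵐ ω ∂P, IsLeastNormSolution (consMatrix (sketchRows w (S ω))) (Fin.cons c 0)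
      (sketchSolution w c (S ω)) := by
  have hv : ((m : ℝ≥0)⁻¹) ≠ 0 := inv_ne_zero (by exact_mod_cast (by omega : m ≠ 0))
  have hlaw := hS.hasLaw_sketchRows hw
  have h := ae_prod_linearIndependent_cons hv hNm (ae_pi_linearIndependent hv hNm.le)
  rw [← hlaw.map_eq] at h
  filter_upwards [ae_of_ae_map hlaw.aemeasurable h] with ω hω
  exact isLeastNormSolution_normalSolution (linearIndependent_row_consMatrix.2 hω) _

theorem IsGaussianSketch.aemeasurable_sketchSolution (hS : IsGaussianSketch P S)
    (hw : Orthonormal ℝ w) (c : ℝ) : AEMeasurable (fun ω => sketchSolution w c (S ω)) P :=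
  (measurable_normalSolution continuous_consMatrix _).comp_aemeasurable
    (hS.hasLaw_sketchRows hw).aemeasurable

theorem IsGaussianSketch.integrable_norm_sq_sketchSolution (hS : IsGaussianSketch P S)
    (hw : Orthonormal ℝ w) (hNm : N + 2 < m) (c : ℝ) :
    Integrable (fun ω => ‖sketchSolution w c (S ω)‖ ^ 2) P ∧
    ∫ ω, ‖sketchSolution w c (S ω)‖ ^ 2 ∂P = m * (c ^ 2 / (m - N - 2)) := by
  have hm0 : m ≠ 0 := by omega
  have hv : ((m : ℝ≥0)⁻¹) ≠ 0 := inv_ne_zero (by exact_mod_cast hm0)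
  have hNm' : (N : ℝ) + 2 < m := by exact_mod_cast hNm
  have hmeas := hS.aemeasurable_sketchSolution hw c
  have h1 := (hS.hasLaw_sketchRows hw).lintegral_comp
    (f := fun q => ENNReal.ofReal (‖normalSolution (consMatrix q) (Fin.cons c 0)‖ ^ 2))
    ((measurable_normalSolution continuous_consMatrix _).norm.pow_const
      2).ennreal_ofReal.aemeasurable
  rw [lintegral_norm_sq_normalSolution hv hNm c] at h1
  have hval : c ^ 2 / (((m : ℝ≥0)⁻¹ : ℝ≥0) * (m - N - 2) : ℝ) = m * (c ^ 2 / (m - N - 2)) := by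
    have : (m : ℝ) - N - 2 ≠ 0 := by linarith
    push_cast
    field_simp
  rw [hval] at h1
  have hnn : 0 ≤ m * (c ^ 2 / (m - N - 2) : ℝ) := by
    have : 0 ≤ (m : ℝ) - N - 2 := by linarith
    positivity
  have hint : Integrable (fun ω => ‖sketchSolution w c (S ω)‖ ^ 2) P := by
    refine ⟨(hmeas.norm.pow_const 2).aestronglyMeasurable, ?_⟩
    rw [hasFiniteIntegral_iff_ofReal (ae_of_all _ fun ω => sq_nonneg _)]
    exact h1.trans_lt ENNReal.ofReal_lt_top
  refine ⟨hint, ?_⟩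
  rw [integral_eq_lintegral_of_nonneg_ae (ae_of_all _ fun ω => sq_nonneg _) hint.1]
  exact (congrArg ENNReal.toReal h1).trans (ENNReal.toReal_ofReal hnn)

/-- The sketched solution depends on the images of row-space vectors only, so it is independent of
the images of kernel vectors. -/
theorem IsGaussianSketch.indepFun_sketchSolution (hS : IsGaussianSketch P S)
    (hwe : Orthonormal ℝ (Sum.elim w e)) (c : ℝ) (j : κ) :
    IndepFun (fun ω => (WithLp.toLp 2 (S ω *ᵥ (e j).ofLp) : EuclideanSpace ℝ (Fin m)))
      (fun ω => sketchSolution w c (S ω)) P := by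
  have h := indepFun_inr_inl (hS.iIndepFun_mulVec hwe) (fun i => hS.aemeasurable_mulVec _) j
  have hrow : Measurable fun g : Fin (N + 1) → EuclideanSpace ℝ (Fin m) =>
      (g 0, fun i : Fin N => g i.succ) := by fun_prop
  exact h.comp measurable_id
    ((measurable_normalSolution continuous_consMatrix (Fin.cons c 0)).comp hrow)

/-- A kernel coordinate of the right-sketch estimator is centred, and its second moment is the
product of the entry variance `1 / m` and the mean of the squared norm of the sketched solution. -/
theorem IsGaussianSketch.sketchCoord_moments (hS : IsGaussianSketch P S)
    (hwe : Orthonormal ℝ (Sum.elim w e)) (hNm : N + 2 < m) (c : ℝ) (j : κ) :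
    MemLp (fun ω => sketchCoord w c (e j) (S ω)) 2 P ∧
    ∫ ω, sketchCoord w c (e j) (S ω) ∂P = 0 ∧
    ∫ ω, sketchCoord w c (e j) (S ω) ^ 2 ∂P = c ^ 2 / (m - N - 2) := by
  have hw : Orthonormal ℝ w := hwe.comp Sum.inl Sum.inl_injective
  have hh := hS.hasLaw_mulVec (hwe.1 (Sum.inr j))
  have hZ := hS.aemeasurable_sketchSolution hw c
  have hind := hS.indepFun_sketchSolution hwe c j
  obtain ⟨hint, hval⟩ := hS.integrable_norm_sq_sketchSolution hw hNm c
  refine ⟨memLp_inner hh hZ hind hint, integral_inner_eq_zero hh hZ hind hint, ?_⟩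
  refine (integrable_inner_sq_and_integral hh hZ hind hint).2.trans ?_
  rw [hval]
  have hm0 : (m : ℝ) ≠ 0 := by exact_mod_cast (by omega : m ≠ 0)
  push_cast
  field_simp

end SingleSketch

/-! ### Averaging and the error of the right sketch -/

section Averaging

variable {N d m q : ℕ} {Ω : Type*} [MeasurableSpace Ω] {P : Measure Ω} [IsProbabilityMeasure P]
  {S : Fin q → Ω → Matrix (Fin m) (Fin d) ℝ} {w : Fin (N + 1) → EuclideanSpace ℝ (Fin d)}
  {κ : Type*} [Fintype κ] {e : κ → EuclideanSpace ℝ (Fin d)}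

/-- Averaging `q` independent centred coordinates divides their second moment by `q`. -/
theorem integral_average_sketchCoord_sq (hq : 0 < q) (hS : ∀ k, IsGaussianSketch P (S k))
    (hindep : iIndepFun (fun k ω => (fun i j => S k ω i j : Fin m → Fin d → ℝ)) P)
    (hwe : Orthonormal ℝ (Sum.elim w e)) (hNm : N + 2 < m) (c : ℝ) (j : κ) :
    Integrable (fun ω => (1 / (q : ℝ) * ∑ k, sketchCoord w c (e j) (S k ω)) ^ 2) P ∧
    ∫ ω, (1 / (q : ℝ) * ∑ k, sketchCoord w c (e j) (S k ω)) ^ 2 ∂P =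
      1 / (q : ℝ) * (c ^ 2 / (m - N - 2)) := by
  have hmom := fun k => (hS k).sketchCoord_moments hwe hNm c j
  have hind : iIndepFun (fun k ω => sketchCoord w c (e j) (S k ω)) P :=
    hindep.comp (fun _ M => sketchCoord w c (e j) (Matrix.of M))
      fun _ => measurable_sketchCoord w c (e j)
  have hsum : MemLp (fun ω => ∑ k, sketchCoord w c (e j) (S k ω)) 2 P :=
    memLp_finsetSum _ fun k _ => (hmom k).1
  have hmean : ∫ ω, ∑ k, sketchCoord w c (e j) (S k ω) ∂P = 0 := by
    rw [integral_finsetSum _ fun k _ => (hmom k).1.integrable (by norm_num)]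
    exact Finset.sum_eq_zero fun k _ => (hmom k).2.1
  have hvar : ∫ ω, (∑ k, sketchCoord w c (e j) (S k ω)) ^ 2 ∂P = q * (c ^ 2 / (m - N - 2)) := by
    rw [← variance_of_integral_eq_zero hsum.aemeasurable hmean]
    have h1 := IndepFun.variance_sum (s := Finset.univ)
      (X := fun k ω => sketchCoord w c (e j) (S k ω)) (fun k _ => (hmom k).1)
      fun k _ l _ hkl => hind.indepFun hkl
    have h2 : (∑ k, fun ω => sketchCoord w c (e j) (S k ω)) =
        fun ω => ∑ k, sketchCoord w c (e j) (S k ω) := by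
      ext ω
      simp
    rw [h2] at h1
    rw [h1, Finset.sum_congr rfl fun k _ =>
      (variance_of_integral_eq_zero (hmom k).1.aemeasurable (hmom k).2.1).trans (hmom k).2.2]
    simp
  have hq0 : (q : ℝ) ≠ 0 := by exact_mod_cast hq.ne'
  simp_rw [mul_pow]
  refine ⟨hsum.integrable_sq.const_mul _, ?_⟩
  rw [integral_const_mul, hvar]
  field_simp

end Averaging

theorem rightSketchEstimator_eq_and_feasible {n d m : ℕ} {A : Matrix (Fin n) (Fin d) ℝ}
    {b : Fin n → ℝ} {S : Matrix (Fin m) (Fin d) ℝ} {z : EuclideanSpace ℝ (Fin m)}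
    (hz : IsLeastNormSolution (A * Sᵀ) b z) :
    rightSketchEstimator A b S = WithLp.toLp 2 (Sᵀ *ᵥ z.ofLp) ∧
      A *ᵥ (rightSketchEstimator A b S).ofLp = b := by
  have h : rightSketchEstimator A b S = WithLp.toLp 2 (Sᵀ *ᵥ z.ofLp) := by
    rw [rightSketchEstimator, hz.leastNormSolution_eq]
  refine ⟨h, ?_⟩
  rw [h, Matrix.mulVec_mulVec]
  exact hz.1

theorem mulVec_averagedEstimator {n d m q : ℕ} (hq : 0 < q) {A : Matrix (Fin n) (Fin d) ℝ}
    {b : Fin n → ℝ} {S : Fin q → Matrix (Fin m) (Fin d) ℝ}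
    (h : ∀ k, A *ᵥ (rightSketchEstimator A b (S k)).ofLp = b) :
    A *ᵥ (averagedEstimator A b S).ofLp = b := by
  have hq0 : (q : ℝ) ≠ 0 := by exact_mod_cast hq.ne'
  rw [averagedEstimator, WithLp.ofLp_smul, Matrix.mulVec_smul, WithLp.ofLp_sum,
    Matrix.mulVec_sum, Finset.sum_congr rfl fun k _ => h k]
  ext i
  simp [hq0]

/-- Markov's inequality in the form of a lower bound for the probability of a small value. -/
theorem one_sub_div_le_measureReal_le {Ω : Type*} [MeasurableSpace Ω] {P : Measure Ω}
    [IsProbabilityMeasure P] {X : Ω → ℝ} (hX : 0 ≤ᵐ[P] X) (hint : Integrable X P) {ε : ℝ}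
    (hε : 0 < ε) : 1 - (∫ ω, X ω ∂P) / ε ≤ P.real {ω | X ω ≤ ε} := by
  have h1 := mul_meas_ge_le_integral_of_nonneg hX hint ε
  have h2 : 1 ≤ P.real {ω | X ω ≤ ε} + P.real {ω | ε ≤ X ω} := by
    have h3 : {ω | X ω ≤ ε} ∪ {ω | ε ≤ X ω} = Set.univ := by
      ext ω
      simpa using le_total _ _
    have h4 := measureReal_union_le (μ := P) {ω | X ω ≤ ε} {ω | ε ≤ X ω}
    rwa [h3, probReal_univ] at h4
  have h5 : P.real {ω | ε ≤ X ω} ≤ (∫ ω, X ω ∂P) / ε := by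
    rw [le_div_iff₀ hε]
    linarith
  linarith

end RightSketch

theorem mainTheorem7 {n d m q : ℕ} (hnd : n < d) (hm : n + 1 < m) (hq : 0 < q)
    (A : Matrix (Fin n) (Fin d) ℝ) (hA : A.rank = n) (b : Fin n → ℝ) (hb : b ≠ 0)
    {Ω : Type*} [MeasurableSpace Ω] (P : Measure Ω) [IsProbabilityMeasure P]
    (S : Fin q → Ω → Matrix (Fin m) (Fin d) ℝ)
    (hS : ∀ k, RightSketch.IsGaussianSketch P (S k))
    (hindep : iIndepFun (fun k ω => (fun i j => S k ω i j : Fin m → Fin d → ℝ)) P) :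
    -- the original problem and, almost surely, all sketched problems have a unique minimizer
    (∃! x, RightSketch.IsLeastNormSolution A b x) ∧
    (∀ᵐ ω ∂P, ∀ k, ∃! z, RightSketch.IsLeastNormSolution (A * (S k ω)ᵀ) b z) ∧
    0 < RightSketch.cost (RightSketch.leastNormSolution A b) ∧
    -- the exact expected relative error
    Integrable (fun ω => RightSketch.cost
      (RightSketch.averagedEstimator A b (fun k => S k ω))) P ∧
    ((∫ ω, RightSketch.cost (RightSketch.averagedEstimator A b (fun k => S k ω)) ∂P)
        - RightSketch.cost (RightSketch.leastNormSolution A b))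
        / RightSketch.cost (RightSketch.leastNormSolution A b)
      = 1 / (q : ℝ) * (((d : ℝ) - n) / ((m : ℝ) - n - 1)) ∧
    -- the high-probability bound
    ∀ ε : ℝ, 0 < ε →
      1 - 1 / ((q : ℝ) * ε) * (((d : ℝ) - n) / ((m : ℝ) - n - 1)) ≤
        P.real {ω | (RightSketch.cost (RightSketch.averagedEstimator A b (fun k => S k ω))
            - RightSketch.cost (RightSketch.leastNormSolution A b))
            / RightSketch.cost (RightSketch.leastNormSolution A b) ≤ ε} := by
  open RightSketch in
  -- For `n = 0` the vector `b` would vanish.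
  obtain _ | N := n
  · exact (hb (Subsingleton.elim _ _)).elim
  have hsolv := exists_mulVec_eq_of_rank_eq hA b
  have hs := leastNormSolution_spec hsolv
  set s := leastNormSolution A b with hs_def
  have hs0 : s ≠ 0 := by
    intro h
    have h1 := hs.1
    rw [h] at h1
    exact hb (by simpa using h1.symm)
  have hNm : N + 2 < m := by omega
  obtain ⟨w, e, hwe, hfeas, hpyth⟩ := exists_adapted_orthonormal hA hs hs0
  have hw : Orthonormal ℝ w := hwe.comp Sum.inl Sum.inl_injective
  have hpos : 0 < cost s := by
    unfold cost
    positivity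
  -- Almost surely, every sketched problem is solved by the closed form.
  have hae : ∀ᵐ ω ∂P, ∀ k,
      IsLeastNormSolution (A * (S k ω)ᵀ) b (sketchSolution w ‖s‖ (S k ω)) := by
    rw [ae_all_iff]
    intro k
    filter_upwards [(hS k).ae_isLeastNormSolution hw (by omega) ‖s‖] with ω hω
    exact (isLeastNormSolution_sketched_iff hfeas _ _).2 hω
  have hcost : (fun ω => cost (averagedEstimator A b (fun k => S k ω))) =ᵐ[P] fun ω =>
      cost s + ∑ j, (1 / (q : ℝ) * ∑ k, sketchCoord w ‖s‖ (e j) (S k ω)) ^ 2 := by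
    filter_upwards [hae] with ω hω
    have hk := fun k => rightSketchEstimator_eq_and_feasible (hω k)
    unfold cost
    rw [hpyth _ (mulVec_averagedEstimator hq fun k => (hk k).2)]
    congr 1
    refine Finset.sum_congr rfl fun j _ => ?_
    congr 1
    rw [averagedEstimator, inner_smul_right, inner_sum]
    congr 1
    refine Finset.sum_congr rfl fun k _ => ?_
    rw [(hk k).1, inner_transpose_mulVec, real_inner_comm, sketchCoord]
  have havg := fun j => integral_average_sketchCoord_sq hq hS hindep hwe hNm ‖s‖ j
  have hint0 : Integrable (fun ω =>
      ∑ j, (1 / (q : ℝ) * ∑ k, sketchCoord w ‖s‖ (e j) (S k ω)) ^ 2) P :=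
    integrable_finsetSum _ fun j _ => (havg j).1
  have hint : Integrable (fun ω => cost (averagedEstimator A b (fun k => S k ω))) P :=
    ((integrable_const _).add hint0).congr hcost.symm
  have hval : ∫ ω, cost (averagedEstimator A b (fun k => S k ω)) ∂P =
      cost s + ((d : ℝ) - (N + 1)) * (1 / (q : ℝ) * (cost s / (m - N - 2))) := by
    rw [integral_congr_ae hcost, integral_add (integrable_const _) hint0,
      integral_finsetSum _ fun j _ => (havg j).1, Finset.sum_congr rfl fun j _ => (havg j).2]
    simp [cost, Nat.cast_sub hnd.le]
  have hrel : ((∫ ω, cost (averagedEstimator A b (fun k => S k ω)) ∂P) - cost s) / cost s =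
      1 / (q : ℝ) * (((d : ℝ) - (N + 1 : ℕ)) / ((m : ℝ) - (N + 1 : ℕ) - 1)) := by
    rw [hval, div_eq_iff hpos.ne']
    have : (m : ℝ) - (N + 1 : ℕ) - 1 = m - N - 2 := by push_cast; ring
    rw [this]
    push_cast
    ring
  refine ⟨existsUnique_isLeastNormSolution A b hsolv, ?_, hpos, hint, hrel, fun ε hε => ?_⟩
  · filter_upwards [hae] with ω hω k
    exact existsUnique_isLeastNormSolution _ b ⟨_, (hω k).1⟩
  · have hnonneg : 0 ≤ᵐ[P] fun ω =>
        (cost (averagedEstimator A b (fun k => S k ω)) - cost s) / cost s := by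
      filter_upwards [hcost] with ω hω
      rw [hω, add_sub_cancel_left]
      exact div_nonneg (Finset.sum_nonneg fun j _ => sq_nonneg _) hpos.le
    have hmarkov := one_sub_div_le_measureReal_le hnonneg
      ((hint.sub (integrable_const _)).div_const _) hε
    rw [integral_div, integral_sub hint (integrable_const _), integral_const, probReal_univ,
      one_smul, hrel] at hmarkov
    refine le_trans (le_of_eq ?_) hmarkov
    ring
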